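/- All spaces are Tychonoff. A cozero-set (zero-set) of a space $Z$ is a set $\{z : f(z)\neq 0\}$ (resp. $\{z : f(z)=0\}$) with $f\colon Z\to\mathbb R$ continuous. $Z$ is an \emph{$F$-space} if disjoint cozero-sets of $Z$ are contained in disjoint zero-sets of $Z$. A closed set $A\subseteq Z$ is a \emph{$P$-set} if every countable intersection of neighbourhoods of $A$ is a neighbourhood of $A$; it is \emph{nicely placed} if for every open $U\supseteq A$ there is a cozero-set $V$ of $Z$ with $A\subseteq V\subseteq U$. A set $A\subseteq Z$ is \emph{$C^*$-embedded} if every continuous $f\colon A\to[0,1]$ extends to a continuous $\bar f\colon Z\to[0,1]$. Let $\mathbb N^*=\beta\mathbb N\setminus\mathbb N$. Let $X=\omega_1\cup\{p\}$, where the points of $\omega_1$ are isolated and the open sets containing $p$ are the sets containing $p$ with countable complement. Let $S=\omega_1\times\mathbb N^*$ with $\omega_1$ discrete. For a cozero-set $C$ of $\mathbb N^*$ put $$K_C=\bigcap_{\alpha\in\omega_1}\operatorname{cl}_{\beta S}\Bigl(\bigcup_{\gamma>\alpha}\{\gamma\}\times C\Bigr),\qquad Y_C=\beta S\setminus K_C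 .$$ (1) There is a cozero-set $C$ of $\mathbb N^*$ whose closure is not a zero-set of $\mathbb N^*$. (2) For every such $C$, writing $Y=Y_C$: the space $Y$ is a locally compact $F$-space; $X\times Y$ is Tychonoff and is not an $F$-space; the family $\{\{x\}\times Y : x\in X\}$ covers $X\times Y$, has cardinality exactly $\aleph_1$, and each of its members is a $P$-set of $X\times Y$, is $C^*$-embedded in $X\times Y$ and is itself an $F$-space; for $q\in X\setminus\{p\}$ the set $\{q\}\times Y$ is clopen, hence nicely placed, in $X\times Y$; but $\{p\}\times Y$ is not nicely placed in $X\times Y$. (3) Consequently the hypothesis "nicely placed" cannot be dropped from the theorem that a Tychonoff space with a cover by at most $\omega_1$ many nicely placed $P$-sets, each of them a $C^*$-embedded $F$-subspace, is an $F$-space: it is not true that every Tychonoff space with a cover by at most $\aleph_1$ many $P$-sets, each of them a $C^*$-embedded $F$-subspace, is an $F$-space. -/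

import Mathlib

open Set Topology
open scoped Cardinal Ordinal

/-! ### Cozero-sets, `F`-spaces, `P`-sets, nicely placed sets, `C*`-embedding -/

/-- A cozero-set: the set where some continuous real-valued function does not vanish. -/
def IsCozeroSet {X : Type*} [TopologicalSpace X] (U : Set X) : Prop :=
  ∃ f : C(X, ℝ), U = {x | f x ≠ 0}

/-- A zero-set: the set where some continuous real-valued function vanishes. -/
def IsZeroSet {X : Type*} [TopologicalSpace X] (Z : Set X) : Prop :=
  ∃ f : C(X, ℝ), Z = {x | f x = 0}

/-- An `F`-space: disjoint cozero-sets are contained in disjoint zero-sets. -/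
def IsFSpace (X : Type*) [TopologicalSpace X] : Prop :=
  ∀ U V : Set X, IsCozeroSet U → IsCozeroSet V → Disjoint U V →
    ∃ Z W : Set X, IsZeroSet Z ∧ IsZeroSet W ∧ U ⊆ Z ∧ V ⊆ W ∧ Disjoint Z W

/-- A `P`-set: a closed set such that the intersection of countably many neighbourhoods of it is
again a neighbourhood of it. -/
def IsPSet {X : Type*} [TopologicalSpace X] (A : Set X) : Prop :=
  IsClosed A ∧ ∀ N : ℕ → Set X, (∀ n, N n ∈ 𝓝ˢ A) → (⋂ n, N n) ∈ 𝓝ˢ A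

/-- A nicely placed set: a closed set `A` such that between `A` and any open set that contains it
there is a cozero-set. -/
def IsNicelyPlaced {X : Type*} [TopologicalSpace X] (A : Set X) : Prop :=
  IsClosed A ∧ ∀ U : Set X, IsOpen U → A ⊆ U → ∃ V : Set X, IsCozeroSet V ∧ A ⊆ V ∧ V ⊆ U

/-- A `C*`-embedded set: every continuous function from it to `[0, 1]` extends continuously to the
whole space. -/
def IsCStarEmbedded {X : Type*} [TopologicalSpace X] (A : Set X) : Prop :=
  ∀ f : C(A, unitInterval), ∃ g : C(X, unitInterval), ∀ a : A, g a = f a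

/-! ### The spaces -/

/-- The Čech–Stone remainder `ℕ* = βℕ ∖ ℕ`, a subspace of `βℕ`. -/
abbrev NStar : Type :=
  ((range (stoneCechUnit : ℕ → StoneCech ℕ))ᶜ : Set (StoneCech ℕ))

/-- The well-ordered set of all countable ordinals. -/
def Omega1 : Type := (ω₁ : Ordinal.{0}).ToType

noncomputable instance : LinearOrder Omega1 :=
  inferInstanceAs (LinearOrder (ω₁ : Ordinal.{0}).ToType)

/-- `ω₁` carries the discrete topology here. -/
instance : TopologicalSpace Omega1 := ⊥

instance : DiscreteTopology Omega1 := ⟨rfl⟩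

/-- The space `X = ω₁ ∪ {p}`. -/
inductive DowX : Type
  | ofOmega1 (α : Omega1) : DowX
  | p : DowX

/-- The points of `ω₁` are isolated in `X`, and the open sets around `p` are the sets containing `p`
that have a countable complement. -/
instance : TopologicalSpace DowX where
  IsOpen U := DowX.p ∈ U → Uᶜ.Countable
  isOpen_univ := fun _ => by simp
  isOpen_inter := fun U V hU hV h => by
    rw [compl_inter]
    exact (hU h.1).union (hV h.2)
  isOpen_sUnion := fun 𝒰 h hp => by
    obtain ⟨U, hU, hpU⟩ := hp
    exact (h U hU hpU).mono (compl_subset_compl.2 (subset_sUnion_of_mem hU))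

/-- The space `S = ω₁ × ℕ*`. -/
abbrev DowS : Type := Omega1 × NStar

/-- The set `K = ⋂_α cl_{βS} (⋃_{γ > α} {γ} × C)`. -/
def dowK (C : Set NStar) : Set (StoneCech DowS) :=
  ⋂ α : Omega1, closure (stoneCechUnit '' ⋃ γ ∈ Ioi α, ({γ} : Set Omega1) ×ˢ C)

/-- The space `Y = βS ∖ K`. -/
abbrev DowY (C : Set NStar) : Type := ((dowK C)ᶜ : Set (StoneCech DowS))

/-- The set `{x} × Y` in `X × Y`. -/
def dowFiber (C : Set NStar) (x : DowX) : Set (DowX × DowY C) :=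
  {x} ×ˢ univ

/-!
The three clauses rest on two properties of `ℕ*`, both obtained by extending functions to `βℕ` and
looking at their traces on `ℕ`. First, disjoint cozero-sets of `ℕ*` are separated by a clopen set
(`cozeroClopenSeparated_nStar`). This property passes to the sum `S = ω₁ × ℕ*`, and then to `Y`,
because a clopen subset of `S` extends to a clopen subset of `βS` and `S` is dense in `Y`. Second, a
nonempty zero-set of `ℕ*` has nonempty interior (`nonempty_interior_of_isZeroSet`). If the closure
of a cozero-set were a zero-set, then so would be its boundary, which is nowhere dense and hence
empty; so any cozero-set that is not closed proves the first clause.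

For the counterexample, let `C` be the cozero-set of `c : ℕ* → [0, 1]`, with a closure that is not a
zero-set. A point of `Y` is not in `K`, so it has a neighbourhood that meets `{γ} × C` for countably
many `γ` only. Hence the function on `X × Y` with value `c n` at `(γ, (γ, n))` and `0` at the other
points of `X × S` is continuous, and vanishes near `{p} × Y` (`eventually_diagFun_eq_zero`).

On the other hand, let `H` be continuous on `X × Y` and `0` at all `(γ, (γ, n))` with `n ∈ C`. As
the closure of `C` is not a zero-set, each `H (γ, (γ, ·))` has a zero `n γ` outside that closure. The
points `(γ, n γ)` accumulate at some `y ∈ βS` at infinity; `y ∉ K`, since a continuous function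
separates them from `ω₁ × C`. So `y ∈ Y`, and `H (p, y) = 0` (`exists_eq_zero_at_p`). If a
cozero-set lay between `{p} × Y` and the interior of the zero-set of the function above, or if
`{(γ, (γ, n)) | n ∈ C}` and the complement of this set in the cozero-set `{c ≠ 0}`, lifted to
`X × Y`, were completely separated, then a suitable `H` would contradict this.

The slices are `P`-sets by the tube lemma, as `X` is a `P`-space and `Y` is locally compact, and
they are `C*`-embedded copies of `Y` because they are retracts.
-/

open Filter

/-! ### Clopen separation of cozero-sets -/

/-- Disjoint cozero-sets can be separated by a clopen set. This is the form in which the `F`-space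
property passes from `ℕ*` to `ω₁ × ℕ*` and to `Y`. -/
def CozeroClopenSeparated (X : Type*) [TopologicalSpace X] : Prop :=
  ∀ f g : C(X, ℝ), (∀ x, f x = 0 ∨ g x = 0) →
    ∃ D : Set X, IsClopen D ∧ (∀ x, f x ≠ 0 → x ∈ D) ∧ (∀ x, g x ≠ 0 → x ∉ D)

theorem IsClopen.isZeroSet {X : Type*} [TopologicalSpace X] {D : Set X} (hD : IsClopen D) :
    IsZeroSet D := by
  classical
  refine ⟨⟨indicator Dᶜ 1, continuous_one.indicator (by simp [hD.compl.frontier_eq])⟩, ?_⟩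
  ext x
  simp [indicator_apply]

theorem IsClopen.isCozeroSet {X : Type*} [TopologicalSpace X] {D : Set X} (hD : IsClopen D) :
    IsCozeroSet D := by
  classical
  refine ⟨⟨indicator D 1, continuous_one.indicator (by simp [hD.frontier_eq])⟩, ?_⟩
  ext x
  simp [indicator_apply]

theorem CozeroClopenSeparated.isFSpace {X : Type*} [TopologicalSpace X]
    (h : CozeroClopenSeparated X) : IsFSpace X := by
  rintro _ _ ⟨f, rfl⟩ ⟨g, rfl⟩ hd
  obtain ⟨D, hD, hf, hg⟩ := h f g fun x => by
    by_contra! hx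
    exact disjoint_left.1 hd hx.1 hx.2
  exact ⟨D, Dᶜ, hD.isZeroSet, hD.compl.isZeroSet, hf, hg, disjoint_compl_right⟩

theorem IsFSpace.of_homeomorph {X Y : Type*} [TopologicalSpace X] [TopologicalSpace Y]
    (e : X ≃ₜ Y) (h : IsFSpace X) : IsFSpace Y := by
  rintro _ _ ⟨f, rfl⟩ ⟨g, rfl⟩ hd
  obtain ⟨_, _, ⟨z, rfl⟩, ⟨w, rfl⟩, hz, hw, hzw⟩ :=
    h {x | f (e x) ≠ 0} {x | g (e x) ≠ 0} ⟨f.comp e, rfl⟩ ⟨g.comp e, rfl⟩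
      (disjoint_left.2 fun x hx hx' => disjoint_left.1 hd hx hx')
  refine ⟨_, _, ⟨z.comp e.symm, rfl⟩, ⟨w.comp e.symm, rfl⟩, fun y hy => ?_, fun y hy => ?_,
    disjoint_left.2 fun x hx hx' => disjoint_left.1 hzw hx hx'⟩
  · exact @hz (e.symm y) (by simpa using hy)
  · exact @hw (e.symm y) (by simpa using hy)

/-- In an `F`-space, disjoint cozero-sets are completely separated. -/
theorem IsFSpace.exists_separating {X : Type*} [TopologicalSpace X] (h : IsFSpace X)
    {U V : Set X} (hU : IsCozeroSet U) (hV : IsCozeroSet V) (hd : Disjoint U V) :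
    ∃ f : C(X, ℝ), (∀ x ∈ U, f x = 0) ∧ ∀ x ∈ V, f x = 1 := by
  obtain ⟨_, _, ⟨z, rfl⟩, ⟨w, rfl⟩, hz, hw, hzw⟩ := h U V hU hV hd
  have hpos : ∀ x, |z x| + |w x| ≠ 0 := fun x hx => by
    have hz0 : z x = 0 := abs_eq_zero.1 (by linarith [abs_nonneg (z x), abs_nonneg (w x)])
    have hw0 : w x = 0 := abs_eq_zero.1 (by linarith [abs_nonneg (z x), abs_nonneg (w x)])
    exact disjoint_left.1 hzw hz0 hw0
  refine ⟨⟨fun x => |z x| / (|z x| + |w x|), by fun_prop (disch := exact hpos _)⟩,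
    fun x hx => ?_, fun x hx => ?_⟩
  · have hz0 : z x = 0 := hz hx
    simp [hz0]
  · have hw0 : w x = 0 := hw hx
    have := hpos x
    simp only [hw0, abs_zero, add_zero] at this
    simp [hw0, div_self this]

/-! ### The remainder `ℕ*` -/

/-- Every clopen set of a space is the trace of a clopen set of its Čech–Stone compactification:
extend the indicator function. -/
theorem exists_isClopen_stoneCech {X : Type*} [TopologicalSpace X] {A : Set X} (hA : IsClopen A) :
    ∃ D : Set (StoneCech X), IsClopen D ∧ ∀ x, stoneCechUnit x ∈ D ↔ x ∈ A := by
  classical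
  have hc : Continuous (fun x => decide (x ∈ A)) :=
    (IsLocallyConstant.iff_continuous _).1 <| by
      refine (IsLocallyConstant.iff_exists_open _).2 fun x => ?_
      by_cases hx : x ∈ A
      · exact ⟨A, hA.isOpen, hx, fun y hy => by simp [hx, hy]⟩
      · exact ⟨Aᶜ, hA.compl.isOpen, hx, fun y hy => by
          have hy' : y ∉ A := hy
          simp [hx, hy']⟩
  refine ⟨stoneCechExtend hc ⁻¹' {true}, (isClopen_discrete _).preimage
    (continuous_stoneCechExtend hc), fun x => by simp⟩

theorem isOpen_singleton_stoneCechUnit {X : Type*} [TopologicalSpace X] [DiscreteTopology X]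
    (x : X) : IsOpen ({stoneCechUnit x} : Set (StoneCech X)) := by
  obtain ⟨D, hD, hDx⟩ := exists_isClopen_stoneCech (isClopen_discrete {x})
  convert hD.isOpen
  refine Subset.antisymm (by simp [hDx]) ?_
  refine (denseRange_stoneCechUnit.open_subset_closure_inter hD.isOpen).trans ?_
  refine closure_minimal ?_ isClosed_singleton
  rintro _ ⟨hy, y, rfl⟩
  rw [show y = x from (hDx y).1 hy]
  rfl

theorem isClosed_nStar :
    IsClosed ((range (stoneCechUnit : ℕ → StoneCech ℕ))ᶜ : Set (StoneCech ℕ)) := by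
  rw [isClosed_compl_iff, ← iUnion_singleton_eq_range]
  exact isOpen_iUnion isOpen_singleton_stoneCechUnit

instance : CompactSpace NStar := isCompact_iff_compactSpace.1 isClosed_nStar.isCompact

/-- The trace on `ℕ` of the neighbourhood filter of a point of `βℕ`. -/
def traceFilter (x : StoneCech ℕ) : Filter ℕ := comap stoneCechUnit (𝓝 x)

instance (x : StoneCech ℕ) : (traceFilter x).NeBot := by
  refine comap_neBot fun t ht => ?_
  obtain ⟨_, hy, y, rfl⟩ := mem_closure_iff_nhds.1 (denseRange_stoneCechUnit x) t ht
  exact ⟨y, hy⟩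

theorem tendsto_traceFilter (x : StoneCech ℕ) : Tendsto stoneCechUnit (traceFilter x) (𝓝 x) :=
  tendsto_comap

theorem traceFilter_le_cofinite (x : NStar) : traceFilter x ≤ cofinite := by
  rw [le_cofinite_iff_compl_singleton_mem]
  intro n
  refine ⟨{stoneCechUnit n}ᶜ, isOpen_compl_singleton.mem_nhds fun h => x.2 ⟨n, h.symm⟩, ?_⟩
  intro m hm hmn
  exact hm (congrArg stoneCechUnit hmn)

/-- Every infinite set of natural numbers has a limit point in `ℕ*`. -/
theorem exists_nStar_limit {A : Set ℕ} (hA : A.Infinite) :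
    ∃ (x : NStar) (l : Filter ℕ), l.NeBot ∧ A ∈ l ∧ Tendsto stoneCechUnit l (𝓝 x.1) := by
  have : (cofinite ⊓ 𝓟 A).NeBot := cofinite_inf_principal_neBot_iff.2 hA
  let u := Ultrafilter.of (cofinite ⊓ 𝓟 A)
  have hu : (u : Filter ℕ) ≤ cofinite ⊓ 𝓟 A := Ultrafilter.of_le _
  obtain ⟨z, -, hlim⟩ := isCompact_univ.ultrafilter_le_nhds
    (u.map (stoneCechUnit : ℕ → StoneCech ℕ)) (by simp)
  refine ⟨⟨z, ?_⟩, u, inferInstance, hu (mem_inf_of_right (mem_principal_self A)), hlim⟩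
  rintro ⟨n, rfl⟩
  have h1 : {m | (stoneCechUnit m : StoneCech ℕ) = stoneCechUnit n} ∈ u :=
    hlim ((isOpen_singleton_stoneCechUnit n).mem_nhds rfl)
  have h2 : ({n}ᶜ : Set ℕ) ∈ u :=
    hu (mem_inf_of_left (finite_singleton n).compl_mem_cofinite)
  obtain ⟨m, hm, hm'⟩ := u.nonempty_of_mem (inter_mem h1 h2)
  exact hm' (isEmbedding_stoneCechUnit.injective hm)

instance : Nonempty NStar := ⟨(exists_nStar_limit infinite_univ).choose⟩

theorem exists_extend_nStar (f : C(NStar, ℝ)) :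
    ∃ F : C(StoneCech ℕ, ℝ), ∀ x : NStar, F x = f x := by
  obtain ⟨F, hF⟩ := ContinuousMap.exists_restrict_eq isClosed_nStar f
  exact ⟨F, fun x => DFunLike.congr_fun hF x⟩

/-- `ℕ*` is an `F`-space: extend `f` and `g` to `βℕ`; the trace on `ℕ` of the separating clopen set
is `{n | |G n| < |F n|}`. -/
theorem cozeroClopenSeparated_nStar : CozeroClopenSeparated NStar := by
  intro f g hfg
  obtain ⟨F, hF⟩ := exists_extend_nStar f
  obtain ⟨G, hG⟩ := exists_extend_nStar g
  obtain ⟨D, hD, hDn⟩ := exists_isClopen_stoneCech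
    (isClopen_discrete {n : ℕ | |G (stoneCechUnit n)| < |F (stoneCechUnit n)|})
  refine ⟨(↑) ⁻¹' D, hD.preimage continuous_subtype_val, fun x hx => ?_, fun x hx hxD => ?_⟩
  · have hlt : |G x| < |F x| := by
      rw [hF, hG, (hfg x).resolve_left hx, abs_zero]
      exact abs_pos.2 hx
    have h1 : ∀ᶠ y in 𝓝 x.1, |G y| < |F y| :=
      (isOpen_lt (by fun_prop) (by fun_prop)).mem_nhds hlt
    by_contra hxD
    have h2 : ∀ᶠ y in 𝓝 x.1, y ∉ D := hD.compl.isOpen.mem_nhds hxD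
    obtain ⟨n, hn1, hn2⟩ := ((tendsto_traceFilter x).eventually (h1.and h2)).exists
    exact hn2 ((hDn n).2 hn1)
  · have hlt : |F x| < |G x| := by
      rw [hF, hG, (hfg x).resolve_right hx, abs_zero]
      exact abs_pos.2 hx
    have h1 : ∀ᶠ y in 𝓝 x.1, |F y| < |G y| :=
      (isOpen_lt (by fun_prop) (by fun_prop)).mem_nhds hlt
    have h2 : ∀ᶠ y in 𝓝 x.1, y ∈ D := hD.isOpen.mem_nhds hxD
    obtain ⟨n, hn1, hn2⟩ := ((tendsto_traceFilter x).eventually (h1.and h2)).exists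
    exact lt_asymm hn1 ((hDn n).1 hn2)

/-- Nonempty zero-sets of `ℕ*` have nonempty interior: if `F` extends `f` to `βℕ`, then `F`
converges to `0` along some sequence of distinct natural numbers, and `f` vanishes at all limit
points of that sequence. -/
theorem nonempty_interior_of_isZeroSet {Z : Set NStar} (hZ : IsZeroSet Z) (hne : Z.Nonempty) :
    (interior Z).Nonempty := by
  obtain ⟨f, rfl⟩ := hZ
  obtain ⟨x, hx : f x = 0⟩ := hne
  obtain ⟨F, hF⟩ := exists_extend_nStar f
  have hfreq : ∀ k : ℕ, ∃ᶠ n in atTop, |F (stoneCechUnit n)| < 1 / ((k : ℝ) + 1) := by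
    intro k
    rw [← Nat.cofinite_eq_atTop]
    refine Frequently.filter_mono (Eventually.frequently ?_) (traceFilter_le_cofinite x)
    refine (tendsto_traceFilter x).eventually
      ((isOpen_lt F.continuous.abs continuous_const).mem_nhds ?_)
    change |F x| < _
    rw [hF, hx, abs_zero]
    positivity
  obtain ⟨φ, hφ, hφF⟩ := extraction_forall_of_frequently hfreq
  have hlim : Tendsto (fun k => F (stoneCechUnit (φ k))) cofinite (𝓝 0) := by
    rw [Nat.cofinite_eq_atTop]
    exact squeeze_zero_norm (fun k => (hφF k).le) tendsto_one_div_add_atTop_nhds_zero_nat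
  obtain ⟨D, hD, hDn⟩ := exists_isClopen_stoneCech (isClopen_discrete (range φ))
  obtain ⟨y, l, hl, hyA, hly⟩ := exists_nStar_limit (infinite_range_of_injective hφ.injective)
  refine ⟨y, mem_interior.2 ⟨(↑) ⁻¹' D, fun z hz => ?_, hD.isOpen.preimage continuous_subtype_val,
    ?_⟩⟩
  · have hr : range φ ∈ traceFilter z := by
      filter_upwards [(tendsto_traceFilter z).eventually (hD.isOpen.mem_nhds hz)] with n hn
      exact (hDn n).1 hn
    have hne : (comap φ (traceFilter z)).NeBot := NeBot.comap_of_range_mem inferInstance hr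
    have h1 : Tendsto (fun k => F (stoneCechUnit (φ k))) (comap φ (traceFilter z)) (𝓝 0) :=
      hlim.mono_left <| (comap_mono (traceFilter_le_cofinite z)).trans
        hφ.injective.comap_cofinite_eq.le
    have h2 : Tendsto (fun k => F (stoneCechUnit (φ k))) (comap φ (traceFilter z)) (𝓝 (F z)) :=
      ((F.continuous.tendsto _).comp (tendsto_traceFilter z)).comp tendsto_comap
    change f z = 0
    rw [← hF]
    exact tendsto_nhds_unique h2 h1
  · exact hD.isClosed.mem_of_tendsto hly (by filter_upwards [hyA] with n hn using (hDn n).2 hn)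

/-- If the closure of a cozero-set of `ℕ*` is a zero-set, then its boundary is a nowhere dense
zero-set, hence empty. -/
theorem isClosed_of_isZeroSet_closure {C : Set NStar} (hC : IsCozeroSet C)
    (hZ : IsZeroSet (closure C)) : IsClosed C := by
  obtain ⟨c, rfl⟩ := hC
  obtain ⟨z, hz⟩ := hZ
  have hopen : IsOpen {x | c x ≠ 0} := isOpen_ne_fun c.continuous continuous_const
  have hfr : frontier {x | c x ≠ 0} = {x | |c x| + |z x| = 0} := by
    rw [hopen.frontier_eq, hz]
    ext x
    change z x = 0 ∧ ¬ c x ≠ 0 ↔ |c x| + |z x| = 0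
    rw [add_eq_zero_iff_of_nonneg (abs_nonneg _) (abs_nonneg _), abs_eq_zero, abs_eq_zero, not_not,
      and_comm]
  have hempty : frontier {x | c x ≠ 0} = ∅ := by
    by_contra hne
    have := nonempty_interior_of_isZeroSet
      ⟨⟨fun x => |c x| + |z x|, by fun_prop⟩, hfr⟩ (nonempty_iff_ne_empty.2 hne)
    rw [← frontier_compl, interior_frontier hopen.isClosed_compl] at this
    exact not_nonempty_empty this
  exact (isClopen_iff_frontier_eq_empty.2 hempty).isClosed

/-- The non-closed cozero-set is given by the extension to `βℕ` of a function on `ℕ` that takes each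
value `1 / (k + 1)` infinitely often. -/
theorem exists_isCozeroSet_not_isClosed : ∃ C : Set NStar, IsCozeroSet C ∧ ¬ IsClosed C := by
  let v : ℕ → unitInterval := fun n =>
    ⟨1 / ((n.unpair.1 : ℝ) + 1), by positivity, by
      rw [div_le_one (by positivity)]; linarith [n.unpair.1.cast_nonneg (α := ℝ)]⟩
  have hv : Continuous v := continuous_of_discreteTopology
  let F : C(NStar, ℝ) := ⟨fun x => (stoneCechExtend hv x.1 : unitInterval),
    continuous_subtype_val.comp ((continuous_stoneCechExtend hv).comp continuous_subtype_val)⟩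
  have hF : ∀ k : ℕ, ∃ x, F x = 1 / ((k : ℝ) + 1) := by
    intro k
    obtain ⟨x, l, hl, hA, hx⟩ := exists_nStar_limit
      (infinite_range_of_injective (f := fun b => Nat.pair k b) fun a b hab => by
        simpa using congrArg (fun n => n.unpair.2) hab)
    refine ⟨x, ?_⟩
    have h1 := ((continuous_subtype_val.comp (continuous_stoneCechExtend hv)).tendsto _).comp hx
    refine tendsto_nhds_unique h1 (tendsto_const_nhds.congr' ?_)
    filter_upwards [hA] with n hn
    obtain ⟨b, rfl⟩ := hn
    simp [v]
  refine ⟨{x | F x ≠ 0}, ⟨F, rfl⟩, fun hcl => ?_⟩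
  obtain ⟨x0, hx0⟩ := hF 0
  obtain ⟨x, hx, hmin⟩ := hcl.isCompact.exists_isMinOn ⟨x0, by simp [hx0]⟩ F.continuous.continuousOn
  have hpos : 0 < F x := lt_of_le_of_ne (stoneCechExtend hv x.1).2.1 (Ne.symm hx)
  obtain ⟨k, hk⟩ := exists_nat_one_div_lt hpos
  obtain ⟨y, hy⟩ := hF k
  have hy0 : F y ≠ 0 := by rw [hy]; positivity
  have : F x ≤ F y := hmin hy0
  linarith

/-! ### The spaces `ω₁` and `X` -/

theorem mk_omega1 : #Omega1 = ℵ₁ := by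
  change #(ω₁ : Ordinal.{0}).ToType = ℵ₁
  rw [Cardinal.mk_toType, Ordinal.card_omega]

theorem countable_Iic_omega1 (α : Omega1) : (Iic α).Countable := by
  have h : #(Iio α) < ℵ₁ := by
    rw [← mk_omega1]
    refine Cardinal.mk_Iio_lt (α := (ω₁ : Ordinal.{0}).ToType) α ?_
    rw [Ordinal.type_toType, Cardinal.mk_toType, Ordinal.card_omega, Cardinal.ord_aleph]
  rw [← Iio_insert]
  refine Countable.insert _ ?_
  rwa [← Cardinal.le_aleph0_iff_set_countable, ← Order.lt_succ_iff, Cardinal.succ_aleph0]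

instance : Uncountable Omega1 := by
  rw [← Cardinal.aleph0_lt_mk_iff, mk_omega1]
  exact Cardinal.aleph0_lt_aleph_one

namespace DowX

theorem isOpen_iff {U : Set DowX} : IsOpen U ↔ (p ∈ U → Uᶜ.Countable) := Iff.rfl

theorem eventually_nhds_p {P : DowX → Prop} (hp : P p) (h : {x | ¬ P x}.Countable) :
    ∀ᶠ x in 𝓝 p, P x :=
  IsOpen.mem_nhds (s := {x | P x}) (isOpen_iff.2 fun _ => h) hp

theorem isClopen_of_p_notMem {U : Set DowX} (hU : p ∉ U) (hc : U.Countable) : IsClopen U :=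
  ⟨isOpen_compl_iff.1 (isOpen_iff.2 fun _ => by rwa [compl_compl]),
    isOpen_iff.2 fun h => (hU h).elim⟩

theorem isClopen_singleton (γ : Omega1) : IsClopen {ofOmega1 γ} :=
  isClopen_of_p_notMem (by simp) (countable_singleton _)

theorem mk_eq : #DowX = ℵ₁ := by
  let e : DowX ≃ Option Omega1 :=
    { toFun := fun | ofOmega1 α => some α | p => none
      invFun := fun | some α => ofOmega1 α | none => p
      left_inv := by rintro (_ | _) <;> rfl
      right_inv := by rintro (_ | _) <;> rfl }
  rw [Cardinal.mk_congr e, Cardinal.mk_option, mk_omega1]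
  exact Cardinal.add_one_eq (Cardinal.aleph0_le_aleph 1)

theorem tendsto_ofOmega1 {l : Filter Omega1} (hl : l ≤ cocountable) :
    Tendsto ofOmega1 l (𝓝 p) := by
  intro N hN
  obtain ⟨U, hUN, hU, hpU⟩ := mem_nhds_iff.1 hN
  refine hl (mem_cocountable.2 ?_)
  have hinj : Function.Injective ofOmega1 := fun a b h => by injection h
  refine (((isOpen_iff.1 hU) hpU).preimage hinj).mono ?_
  exact fun α hα hαU => hα (hUN hαU)

instance : T1Space DowX :=
  ⟨fun x => isOpen_compl_iff.1 (isOpen_iff.2 fun _ => by simp)⟩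

/-- A closed set that misses `p` is clopen, and so is every `{α}`: the space is zero-dimensional. -/
instance : T35Space DowX where
  completely_regular x K hK hx := by
    classical
    obtain ⟨D, hD, hxD, hKD⟩ : ∃ D : Set DowX, IsClopen D ∧ x ∉ D ∧ K ⊆ D := by
      cases x with
      | ofOmega1 α => exact ⟨_, (isClopen_singleton α).compl, by simp,
          fun y hy hyx => hx (hyx ▸ hy)⟩
      | p => exact ⟨K, ⟨hK, isOpen_iff.2 fun h => (hx h).elim⟩, hx, Subset.rfl⟩
    refine ⟨indicator D 1, continuous_one.indicator (by simp [hD.frontier_eq]), ?_, fun y hy => ?_⟩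
    · exact indicator_of_notMem hxD _
    · exact indicator_of_mem (hKD hy) _

/-- `X` is a `P`-space. -/
instance (x : DowX) : CountableInterFilter (𝓝 x) := by
  cases x with
  | ofOmega1 α =>
    rw [show 𝓝 (ofOmega1 α) = 𝓟 {ofOmega1 α} by
      rw [principal_singleton]
      exact (isOpen_singleton_iff_nhds_eq_pure _).1 (isClopen_singleton α).isOpen]
    infer_instance
  | p =>
    refine ⟨fun S hS h => ?_⟩
    choose! U hU hUo hpU using fun s hs => mem_nhds_iff.1 (h s hs)
    refine mem_of_superset (eventually_nhds_p (P := fun x => ∀ s ∈ S, x ∈ U s) hpU ?_)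
      fun x hx s hs => hU s hs (hx s hs)
    refine (hS.biUnion fun s hs => isOpen_iff.1 (hUo s hs) (hpU s hs)).mono fun x hx => ?_
    obtain ⟨s, hs, hxs⟩ : ∃ s ∈ S, x ∉ U s := by
      by_contra! hxU
      exact hx hxU
    exact mem_biUnion hs hxs

end DowX

/-! ### Slices of a product with a locally compact space -/

/-- The tube lemma, applied at each compact neighbourhood of a point of `Y`. -/
theorem isPSet_singleton_prod_univ {X Y : Type*} [TopologicalSpace X] [TopologicalSpace Y]
    [T1Space X] [LocallyCompactSpace Y] (x : X) [CountableInterFilter (𝓝 x)] :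
    IsPSet (({x} : Set X) ×ˢ (univ : Set Y)) := by
  refine ⟨isClosed_singleton.prod isClosed_univ, fun N hN => ?_⟩
  rw [mem_nhdsSet_iff_forall]
  rintro ⟨x', y⟩ ⟨rfl, -⟩
  obtain ⟨K, hK, hKy⟩ := exists_compact_mem_nhds y
  have hT : ∀ n, ∃ T ∈ 𝓝 x', T ×ˢ K ⊆ N n := by
    intro n
    have h1 : N n ∈ 𝓝ˢ (({x'} : Set X) ×ˢ K) :=
      nhdsSet_mono (prod_mono Subset.rfl (subset_univ _)) (hN n)
    rw [isCompact_singleton.nhdsSet_prod_eq hK, nhdsSet_singleton, mem_prod_iff] at h1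
    obtain ⟨T, hT, W, hW, hTW⟩ := h1
    exact ⟨T, hT, (prod_mono Subset.rfl (subset_of_mem_nhdsSet hW)).trans hTW⟩
  choose T hT hTN using hT
  filter_upwards [prod_mem_nhds (countable_iInter_mem.2 hT) hKy] with q hq
  exact mem_iInter.2 fun n => hTN n ⟨mem_iInter.1 hq.1 n, hq.2⟩

theorem isCStarEmbedded_singleton_prod_univ {X Y : Type*} [TopologicalSpace X]
    [TopologicalSpace Y] (x : X) : IsCStarEmbedded (({x} : Set X) ×ˢ (univ : Set Y)) := by
  intro f
  refine ⟨⟨fun q => f ⟨(x, q.2), rfl, trivial⟩, by fun_prop⟩, ?_⟩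
  rintro ⟨⟨x', y⟩, rfl, -⟩
  rfl

/-- The slice `{x} × Y` is homeomorphic to `Y`. -/
def singletonProdUnivHomeomorph {X Y : Type*} [TopologicalSpace X] [TopologicalSpace Y] (x : X) :
    Y ≃ₜ (({x} : Set X) ×ˢ (univ : Set Y) : Set (X × Y)) where
  toFun y := ⟨(x, y), rfl, trivial⟩
  invFun q := q.1.2
  left_inv _ := rfl
  right_inv := by
    rintro ⟨⟨x', y⟩, rfl, -⟩
    rfl
  continuous_toFun := by fun_prop
  continuous_invFun := by fun_prop

/-! ### The spaces `S = ω₁ × ℕ*` and `Y = βS ∖ K` -/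

theorem cozeroClopenSeparated_dowS : CozeroClopenSeparated DowS := by
  intro f g hfg
  have h := fun γ : Omega1 => cozeroClopenSeparated_nStar
    ⟨fun n => f (γ, n), by fun_prop⟩ ⟨fun n => g (γ, n), by fun_prop⟩ fun n => hfg (γ, n)
  choose D hD hf hg using h
  have hopen : ∀ E : Omega1 → Set NStar, (∀ γ, IsOpen (E γ)) →
      IsOpen {s : DowS | s.2 ∈ E s.1} := fun E hE => by
    rw [isOpen_iff_mem_nhds]
    rintro ⟨γ, n⟩ hn
    filter_upwards [prod_mem_nhds ((isOpen_discrete {γ}).mem_nhds rfl) ((hE γ).mem_nhds hn)]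
    rintro ⟨γ', n'⟩ ⟨rfl, hn'⟩
    exact hn'
  exact ⟨{s | s.2 ∈ D s.1}, ⟨isOpen_compl_iff.1 (hopen _ fun γ => (hD γ).compl.isOpen),
    hopen D fun γ => (hD γ).isOpen⟩, fun s hs => hf s.1 s.2 hs, fun s hs => hg s.1 s.2 hs⟩

/-- No point of `S` is in `K`: the clopen set `{γ} × ℕ*` misses `⋃_{γ' > γ} {γ'} × C`. -/
theorem stoneCechUnit_notMem_dowK (C : Set NStar) (s : DowS) : stoneCechUnit s ∉ dowK C := by
  intro hs
  obtain ⟨D, hD, hDs⟩ := exists_isClopen_stoneCech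
    ((isClopen_discrete {s.1}).preimage (continuous_fst : Continuous (Prod.fst : DowS → Omega1)))
  obtain ⟨_, hz, s', hs', rfl⟩ :=
    mem_closure_iff.1 (mem_iInter.1 hs s.1) D hD.isOpen ((hDs s).2 rfl)
  obtain ⟨γ, hγ, hsγ⟩ := mem_iUnion₂.1 hs'
  have h1 : s'.1 = s.1 := (hDs s').1 hz
  have h2 : s'.1 = γ := hsγ.1
  exact (ne_of_gt (mem_Ioi.1 hγ)) (h2.symm.trans h1)

/-- The inclusion of `S` in `Y`. -/
def dowUnit (C : Set NStar) (s : DowS) : DowY C := ⟨stoneCechUnit s, stoneCechUnit_notMem_dowK C s⟩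

theorem continuous_dowUnit (C : Set NStar) : Continuous (dowUnit C) :=
  continuous_stoneCechUnit.subtype_mk _

theorem isOpen_compl_dowK (C : Set NStar) : IsOpen (dowK C)ᶜ :=
  (isClosed_iInter fun _ => isClosed_closure).isOpen_compl

theorem denseRange_dowUnit (C : Set NStar) : DenseRange (dowUnit C) := by
  intro y
  rw [mem_closure_iff]
  intro O hO hy
  obtain ⟨_, ⟨z, hz, hzs⟩, s, rfl⟩ := mem_closure_iff.1 (denseRange_stoneCechUnit y.1) _
    ((isOpen_compl_dowK C).isOpenMap_subtype_val O hO) ⟨y, hy, rfl⟩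
  exact ⟨z, hz, s, Subtype.ext hzs.symm⟩

instance (C : Set NStar) : LocallyCompactSpace (DowY C) :=
  (isOpen_compl_dowK C).locallyCompactSpace

/-- `Y` is an `F`-space, because it lies between the `F`-space `S` and `βS`. -/
theorem cozeroClopenSeparated_dowY (C : Set NStar) : CozeroClopenSeparated (DowY C) := by
  intro f g hfg
  obtain ⟨D, hD, hf, hg⟩ := cozeroClopenSeparated_dowS (f.comp ⟨_, continuous_dowUnit C⟩)
    (g.comp ⟨_, continuous_dowUnit C⟩) fun s => hfg _
  obtain ⟨E, hE, hEs⟩ := exists_isClopen_stoneCech hD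
  have hE' : IsClopen ((↑) ⁻¹' E : Set (DowY C)) := hE.preimage continuous_subtype_val
  refine ⟨(↑) ⁻¹' E, hE', fun y hy => ?_, fun y hy hyE => ?_⟩
  · by_contra hyE
    obtain ⟨s, hs, hsE⟩ := (denseRange_dowUnit C).exists_mem_open
      ((isOpen_ne_fun f.continuous continuous_const).inter hE'.compl.isOpen) ⟨y, hy, hyE⟩
    exact hsE ((hEs s).2 (hf s hs))
  · obtain ⟨s, hs, hsE⟩ := (denseRange_dowUnit C).exists_mem_open
      ((isOpen_ne_fun g.continuous continuous_const).inter hE'.isOpen) ⟨y, hy, hyE⟩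
    exact hg s hs ((hEs s).1 hsE)

/-- If no `n γ` is in the closure of `C`, then the points `(γ, n γ)` accumulate at infinity at a
point of `Y`: a continuous function on `S` separates them from `ω₁ × C`, so that their limits in
`βS` are not in `K`. -/
theorem exists_dowY_limit {C : Set NStar} {n : Omega1 → NStar} (hn : ∀ γ, n γ ∉ closure C) :
    ∃ (l : Filter Omega1) (y : DowY C), l.NeBot ∧ l ≤ cocountable ∧
      Tendsto (fun γ => dowUnit C (γ, n γ)) l (𝓝 y) := by
  have : (cocountable : Filter Omega1).NeBot := ⟨fun h => by
    have h1 : (∅ : Set Omega1) ∈ (cocountable : Filter Omega1) := h ▸ mem_bot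
    rw [mem_cocountable, compl_empty, countable_univ_iff] at h1
    exact not_countable h1⟩
  let u := Ultrafilter.of (cocountable : Filter Omega1)
  obtain ⟨z, -, hz⟩ := isCompact_univ.ultrafilter_le_nhds
    (u.map fun γ => (stoneCechUnit (γ, n γ) : StoneCech DowS)) (by simp)
  have hlim : Tendsto (fun γ => (stoneCechUnit (γ, n γ) : StoneCech DowS)) u (𝓝 z) := hz
  choose s hs hsn hsC using fun γ => CompletelyRegularSpace.completely_regular (n γ) (closure C)
    isClosed_closure (hn γ)
  have hcont : Continuous fun t : DowS => s t.1 t.2 :=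
    continuous_prod_of_discrete_left.2 fun γ => hs γ
  have hzK : z ∉ dowK C := fun hzK => by
    have h0 : stoneCechExtend hcont z = 0 := by
      refine tendsto_nhds_unique (((continuous_stoneCechExtend hcont).tendsto z).comp hlim) ?_
      refine tendsto_const_nhds.congr fun γ => ?_
      simp [hsn]
    have h1 : stoneCechExtend hcont z = 1 := by
      -- any index would do, since the separating function is `1` on all of `ω₁ × C`
      obtain ⟨α⟩ : Nonempty Omega1 := inferInstance
      refine closure_minimal (t := stoneCechExtend hcont ⁻¹' {1}) ?_
        (isClosed_singleton.preimage (continuous_stoneCechExtend hcont)) (mem_iInter.1 hzK α)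
      rintro _ ⟨t, ht, rfl⟩
      obtain ⟨γ, -, -, htC⟩ := mem_iUnion₂.1 ht
      rw [mem_preimage, stoneCechExtend_stoneCechUnit]
      exact hsC t.1 (subset_closure htC)
    exact zero_ne_one (h0.symm.trans h1)
  exact ⟨u, ⟨z, hzK⟩, inferInstance, Ultrafilter.of_le _, tendsto_subtype_rng.2 hlim⟩

/-! ### The diagonal function on `X × Y` -/

/-- The function that is `c` on `{γ} × ℕ*` and vanishes on the rest of `S`. -/
noncomputable def sliceFun (c : C(NStar, unitInterval)) (γ : Omega1) (s : DowS) : unitInterval :=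
  if s.1 = γ then c s.2 else 0

theorem continuous_sliceFun (c : C(NStar, unitInterval)) (γ : Omega1) :
    Continuous (sliceFun c γ) :=
  continuous_prod_of_discrete_left.2 fun γ' => by
    by_cases h : γ' = γ
    · simpa [sliceFun, h] using c.continuous
    · simpa [sliceFun, h] using continuous_const

/-- The function on `X × βS` given by `(γ, (γ, n)) ↦ c n`, by `0` at the other points of `ω₁ × S`
and of `{p} × βS`, and by continuous extension on each `{γ} × βS`. -/
noncomputable def diagFun (c : C(NStar, unitInterval)) : DowX → StoneCech DowS → ℝ
  | .ofOmega1 γ, z => (stoneCechExtend (continuous_sliceFun c γ) z : unitInterval)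
  | .p, _ => 0

theorem diagFun_dowUnit (c : C(NStar, unitInterval)) (C : Set NStar) (γ : Omega1) (n : NStar) :
    diagFun c (.ofOmega1 γ) (dowUnit C (γ, n)) = c n := by
  simp [diagFun, dowUnit, sliceFun]

/-- The function vanishes near `{p} × Y`: a point `y` of `Y` has a neighbourhood that misses
`{γ} × C` for all but countably many `γ`. -/
theorem eventually_diagFun_eq_zero {c : C(NStar, unitInterval)} {C : Set NStar}
    (hc : ∀ n, c n ≠ 0 → n ∈ C) (y : DowY C) :
    ∀ᶠ q : DowX × DowY C in 𝓝 (DowX.p, y), diagFun c q.1 q.2 = 0 := by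
  have hy := y.2
  simp only [dowK, mem_compl_iff, mem_iInter, not_forall] at hy
  obtain ⟨α, hα⟩ := hy
  set W := (closure (stoneCechUnit '' ⋃ γ ∈ Ioi α, ({γ} : Set Omega1) ×ˢ C))ᶜ with hW
  have hWo : IsOpen W := isClosed_closure.isOpen_compl
  have h1 : ∀ᶠ x in 𝓝 DowX.p, ∀ z ∈ W, diagFun c x z = 0 := by
    refine DowX.eventually_nhds_p (fun z _ => rfl)
      (((countable_Iic_omega1 α).image DowX.ofOmega1).mono fun x hx => ?_)
    cases x with
    | p => exact (hx fun z _ => rfl).elim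
    | ofOmega1 γ =>
      refine ⟨γ, mem_Iic.2 (not_lt.1 fun hγ => hx fun z hz => ?_), rfl⟩
      have hsub : W ⊆ stoneCechExtend (continuous_sliceFun c γ) ⁻¹' {0} := by
        refine (denseRange_stoneCechUnit.open_subset_closure_inter hWo).trans
          (closure_minimal ?_ (isClosed_singleton.preimage (continuous_stoneCechExtend _)))
        rintro _ ⟨hs, s, rfl⟩
        rw [mem_preimage, stoneCechExtend_stoneCechUnit, mem_singleton_iff, sliceFun]
        by_contra hne
        obtain ⟨hsγ, hsc⟩ := ite_ne_right_iff.1 hne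
        exact hs (subset_closure ⟨s, mem_iUnion₂.2 ⟨γ, hγ, hsγ, hc _ hsc⟩, rfl⟩)
      have h0 : stoneCechExtend (continuous_sliceFun c γ) z = 0 := hsub hz
      simp [diagFun, h0]
  have h2 : ∀ᶠ z : DowY C in 𝓝 y, z.1 ∈ W :=
    (hWo.preimage continuous_subtype_val).mem_nhds hα
  filter_upwards [h1.prod_nhds h2] with q hq using hq.1 _ hq.2

theorem continuous_diagFun {c : C(NStar, unitInterval)} {C : Set NStar}
    (hc : ∀ n, c n ≠ 0 → n ∈ C) :
    Continuous fun q : DowX × DowY C => diagFun c q.1 q.2 := by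
  rw [continuous_iff_continuousAt]
  rintro ⟨x, y⟩
  cases x with
  | p =>
    have h := eventually_diagFun_eq_zero hc y
    exact continuousAt_const.congr (EventuallyEq.symm h)
  | ofOmega1 γ =>
    have hcont : Continuous fun q : DowX × DowY C =>
        ((stoneCechExtend (continuous_sliceFun c γ) q.2.1 : unitInterval) : ℝ) :=
      continuous_subtype_val.comp ((continuous_stoneCechExtend _).comp
        (continuous_subtype_val.comp continuous_snd))
    refine hcont.continuousAt.congr ?_
    filter_upwards [((DowX.isClopen_singleton γ).isOpen.preimage continuous_fst).mem_nhds rfl]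
    rintro ⟨x, z⟩ rfl
    rfl

theorem IsCozeroSet.exists_unitInterval {X : Type*} [TopologicalSpace X] {U : Set X}
    (hU : IsCozeroSet U) : ∃ c : C(X, unitInterval), ∀ x, x ∈ U ↔ c x ≠ 0 := by
  obtain ⟨f, rfl⟩ := hU
  refine ⟨⟨fun x => ⟨min |f x| 1, by positivity, min_le_right _ _⟩, by fun_prop⟩, fun x => ?_⟩
  have : min |f x| 1 = 0 ↔ f x = 0 := by
    constructor
    · intro h
      rcases min_choice |f x| 1 with h' | h' <;> rw [h'] at h
      · exact abs_eq_zero.1 h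
      · exact (one_ne_zero h).elim
    · rintro h
      simp [h]
  exact not_congr ⟨fun h => Subtype.ext (this.2 h), fun h => this.1 (congrArg Subtype.val h)⟩

/-- The contradiction behind both negative results: as the closure of `C` is not a zero-set, for
each `γ` the function `H (γ, (γ, ·))` has a zero `n γ` outside that closure; `H (p, y) = 0` at a
limit `y` of the points `(γ, n γ)`. -/
theorem exists_eq_zero_at_p {C : Set NStar} (hC : ¬ IsZeroSet (closure C))
    (H : C(DowX × DowY C, ℝ)) (hH : ∀ γ, ∀ n ∈ C, H (.ofOmega1 γ, dowUnit C (γ, n)) = 0) :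
    ∃ y, H (.p, y) = 0 := by
  have hex : ∀ γ, ∃ n, n ∉ closure C ∧ H (.ofOmega1 γ, dowUnit C (γ, n)) = 0 := by
    intro γ
    have hcont : Continuous fun n => H (.ofOmega1 γ, dowUnit C (γ, n)) :=
      H.continuous.comp (continuous_const.prodMk ((continuous_dowUnit C).comp
        (continuous_const.prodMk continuous_id)))
    by_contra! hne
    refine hC ⟨⟨_, hcont⟩, Subset.antisymm ?_ fun n hn => by_contra fun h => hne n h hn⟩
    exact closure_minimal (fun n hn => hH γ n hn) (isClosed_singleton.preimage hcont)
  choose n hnC hn using hex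
  obtain ⟨l, y, hl, hle, hy⟩ := exists_dowY_limit hnC
  have h1 := (H.continuous.tendsto (DowX.p, y)).comp
    ((DowX.tendsto_ofOmega1 hle).prodMk_nhds hy)
  exact ⟨y, tendsto_nhds_unique h1 (tendsto_const_nhds.congr fun γ => (hn γ).symm)⟩

/-- The two disjoint cozero-sets of `X × Y` that are not completely separated are
`{(γ, (γ, n)) | n ∈ C}` and, up to points outside `X × S`, `{(x, (γ, n)) | n ∈ C, x ≠ γ}`. -/
theorem not_isFSpace_dow {C : Set NStar} (hC : IsCozeroSet C) (hcl : ¬ IsZeroSet (closure C)) :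
    ¬ IsFSpace (DowX × DowY C) := by
  intro hF
  obtain ⟨c, hc⟩ := hC.exists_unitInterval
  have hu := continuous_diagFun (C := C) fun n => (hc n).2
  have hcS : Continuous fun s : DowS => c s.2 := by fun_prop
  have hv : Continuous fun q : DowX × DowY C =>
      ((stoneCechExtend hcS q.2.1 : unitInterval) : ℝ) - diagFun c q.1 q.2 :=
    (continuous_subtype_val.comp ((continuous_stoneCechExtend _).comp
        (continuous_subtype_val.comp continuous_snd))).sub hu
  have hdisj : ∀ x z, diagFun c x z = 0 ∨
      ((stoneCechExtend hcS z : unitInterval) : ℝ) - diagFun c x z = 0 := by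
    intro x z
    cases x with
    | p => exact Or.inl rfl
    | ofOmega1 γ =>
      rw [← mul_eq_zero]
      have hcont : Continuous fun z => diagFun c (.ofOmega1 γ) z *
          (((stoneCechExtend hcS z : unitInterval) : ℝ) - diagFun c (.ofOmega1 γ) z) := by
        have h1 : Continuous fun z => diagFun c (.ofOmega1 γ) z :=
          continuous_subtype_val.comp (continuous_stoneCechExtend _)
        exact h1.mul ((continuous_subtype_val.comp (continuous_stoneCechExtend _)).sub h1)
      refine congrFun (stoneCech_hom_ext hcont (continuous_const (y := 0)) ?_) z
      funext s
      by_cases h : s.1 = γ <;> simp [diagFun, sliceFun, h]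
  obtain ⟨h, hU, hV⟩ := hF.exists_separating (U := {q | diagFun c q.1 q.2 ≠ 0}) ⟨⟨_, hu⟩, rfl⟩
    ⟨⟨_, hv⟩, rfl⟩ (disjoint_left.2 fun q hq hq' => (hdisj q.1 q.2).elim hq hq')
  obtain ⟨y, hy⟩ := exists_eq_zero_at_p hcl ⟨fun q => |h q| + |h (.p, q.2) - 1|, by fun_prop⟩ <| by
    intro γ n hn
    have hn0 : (c n : ℝ) ≠ 0 := fun h0 => (hc n).1 hn (Subtype.ext h0)
    have h1 : h (.ofOmega1 γ, dowUnit C (γ, n)) = 0 := hU _ <| by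
      change diagFun c (.ofOmega1 γ) (dowUnit C (γ, n)) ≠ 0
      rwa [diagFun_dowUnit]
    have h2 : h (.p, dowUnit C (γ, n)) = 1 := hV _ <| by
      change ((stoneCechExtend hcS (stoneCechUnit (γ, n)) : unitInterval) : ℝ) - 0 ≠ 0
      rwa [stoneCechExtend_stoneCechUnit, sub_zero]
    simp [h1, h2]
  have hy' : |h (.p, y)| + |h (.p, y) - 1| = 0 := hy
  have := abs_sub_abs_le_abs_sub 1 (h (.p, y))
  rw [abs_sub_comm 1, abs_one] at this
  linarith

/-- No cozero-set lies between `{p} × Y` and the interior of the set where `diagFun` vanishes. -/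
theorem not_isNicelyPlaced_dowFiber_p {C : Set NStar} (hC : IsCozeroSet C)
    (hcl : ¬ IsZeroSet (closure C)) : ¬ IsNicelyPlaced (dowFiber C .p) := by
  rintro ⟨-, h⟩
  obtain ⟨c, hc⟩ := hC.exists_unitInterval
  obtain ⟨_, ⟨v, rfl⟩, hpV, hV⟩ := h (interior {q | diagFun c q.1 q.2 = 0}) isOpen_interior <| by
    rintro ⟨_, y⟩ ⟨rfl, -⟩
    exact mem_interior_iff_mem_nhds.2 (eventually_diagFun_eq_zero (fun n => (hc n).2) y)
  obtain ⟨y, hy⟩ := exists_eq_zero_at_p hcl v fun γ n hn => by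
    by_contra hne
    have h0 : diagFun c (.ofOmega1 γ) (dowUnit C (γ, n)) = 0 :=
      (interior_subset (hV hne) : _ ∈ {q : DowX × DowY C | diagFun c q.1 q.2 = 0})
    rw [diagFun_dowUnit] at h0
    exact (hc n).1 hn (Subtype.ext h0)
  exact hpV (show (DowX.p, y) ∈ dowFiber C .p from ⟨rfl, trivial⟩) hy

/-! ### The cover of `X × Y` by slices -/

theorem mk_range_dowFiber (C : Set NStar) : #(range (dowFiber C)) = ℵ₁ := by
  obtain ⟨y⟩ : Nonempty (DowY C) := (inferInstance : Nonempty DowS).map (dowUnit C)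
  rw [Cardinal.mk_range_eq, DowX.mk_eq]
  intro x x' h
  have : (x, y) ∈ dowFiber C x' := h ▸ ⟨rfl, trivial⟩
  exact this.1

theorem sUnion_range_dowFiber (C : Set NStar) : ⋃₀ range (dowFiber C) = univ :=
  eq_univ_of_forall fun q => ⟨_, mem_range_self q.1, rfl, trivial⟩

theorem isPSet_isCStarEmbedded_isFSpace_dowFiber (C : Set NStar) (x : DowX) :
    IsPSet (dowFiber C x) ∧ IsCStarEmbedded (dowFiber C x) ∧ IsFSpace (dowFiber C x) :=
  ⟨isPSet_singleton_prod_univ x, isCStarEmbedded_singleton_prod_univ x,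
    (cozeroClopenSeparated_dowY C).isFSpace.of_homeomorph (singletonProdUnivHomeomorph x)⟩

theorem isClopen_dowFiber (C : Set NStar) {q : DowX} (hq : q ≠ .p) : IsClopen (dowFiber C q) := by
  cases q with
  | ofOmega1 γ => exact (DowX.isClopen_singleton γ).prod isClopen_univ
  | p => exact (hq rfl).elim

theorem IsClopen.isNicelyPlaced {X : Type*} [TopologicalSpace X] {A : Set X} (hA : IsClopen A) :
    IsNicelyPlaced A :=
  ⟨hA.isClosed, fun _ _ hAU => ⟨A, hA.isCozeroSet, Subset.rfl, hAU⟩⟩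

theorem mainTheorem3 :
    -- cozero-sets of `ℕ*` whose closure is not a zero-set exist
    (∃ C : Set NStar, IsCozeroSet C ∧ ¬ IsZeroSet (closure C)) ∧
    -- each of them gives an example
    (∀ C : Set NStar, IsCozeroSet C → ¬ IsZeroSet (closure C) →
      LocallyCompactSpace (DowY C) ∧ IsFSpace (DowY C) ∧
      T35Space (DowX × DowY C) ∧ ¬ IsFSpace (DowX × DowY C) ∧
      ⋃₀ range (dowFiber C) = univ ∧ #(range (dowFiber C)) = ℵ₁ ∧
      (∀ x : DowX, IsPSet (dowFiber C x) ∧ IsCStarEmbedded (dowFiber C x) ∧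
        IsFSpace (dowFiber C x)) ∧
      (∀ q : DowX, q ≠ DowX.p → IsClopen (dowFiber C q) ∧ IsNicelyPlaced (dowFiber C q)) ∧
      ¬ IsNicelyPlaced (dowFiber C DowX.p)) ∧
    -- the union theorem for `P`-sets fails without the hypothesis "nicely placed"
    ¬ (∀ (Z : Type) [TopologicalSpace Z] [T35Space Z] (ℱ : Set (Set Z)),
        #ℱ ≤ ℵ₁ → ⋃₀ ℱ = univ →
        (∀ A ∈ ℱ, IsPSet A ∧ IsCStarEmbedded A ∧ IsFSpace A) → IsFSpace Z) := by
  have hex : ∃ C : Set NStar, IsCozeroSet C ∧ ¬ IsZeroSet (closure C) := by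
    obtain ⟨C, hC, hcl⟩ := exists_isCozeroSet_not_isClosed
    exact ⟨C, hC, fun h => hcl (isClosed_of_isZeroSet_closure hC h)⟩
  refine ⟨hex, fun C hC hcl => ⟨inferInstance, (cozeroClopenSeparated_dowY C).isFSpace,
    inferInstance, not_isFSpace_dow hC hcl, sUnion_range_dowFiber C, mk_range_dowFiber C,
    isPSet_isCStarEmbedded_isFSpace_dowFiber C,
    fun q hq => ⟨isClopen_dowFiber C hq, (isClopen_dowFiber C hq).isNicelyPlaced⟩,
    not_isNicelyPlaced_dowFiber_p hC hcl⟩, fun h => ?_⟩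
  obtain ⟨C, hC, hcl⟩ := hex
  refine not_isFSpace_dow hC hcl (h _ _ (mk_range_dowFiber C).le (sUnion_range_dowFiber C) ?_)
  rintro _ ⟨x, rfl⟩
  exact isPSet_isCStarEmbedded_isFSpace_dowFiber C x
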